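/- Let $G=(V,E)$ be a compact topological packing graph: a (simple) graph whose vertex set is a compact Hausdorff space and in which every finite clique is contained in an open clique (an open subset of $V$ in which every two distinct vertices are adjacent). Its independence number $\alpha(G)$ is then finite. For $t\in\mathbb{N}$ let $I_t$ be the set of independent sets of $G$ with at most $t$ elements, with the subspace topology from the set of all subsets of $V$ with at most $t$ elements; the latter has the quotient topology from $V^t$ under $(v_1,\dots,v_t)\mapsto\{v_1,\dots,v_t\}$, the empty set being added as an isolated point. Let $\mathcal{M}(X)$ denote the signed Radon measures on a compact Hausdorff space $X$, $\mathcal{M}(I_{2t})_{\ge 0}$ the cone of positive ones, $\mathcal{C}(I_t\times I_t)_{\mathrm{sym}}$ the symmetric continuous kernels $K\colon I_t\times I_t\to\mathbb{R}$, $\mathcal{C}(I_t\times I_t)_{\succeq 0}$ those for which all matrices $(K(J_i,J_j))_{i,j=1}^m$ are positive semidefinite, and $\mathcal{M}(I_t\times I_t)_{\succeq 0}$ the cone of symmetric signed Radon measures $\mu$ (that is, $\mu(E\times E')=\mu(E'\times E)$ for all Borel sets $E,E'$) with $\int K\,d\mu\ge 0$ for all $K\in\mathcal{C}(I_t\times I_t)_{\succeq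 0}$. Let $A_t\colon\mathcal{C}(I_t\times I_t)_{\mathrm{sym}}\to\mathcal{C}(I_{2t})$ be given by $A_tK(S)=\sum_{J,J'\in I_t:\,J\cup J'=S}K(J,J')$, and let $A_t^*$ be its adjoint, which maps $\mathcal{M}(I_{2t})$ to the symmetric signed Radon measures on $I_t\times I_t$. The feasible region of $\mathrm{las}_t(G)$ is \[ \mathcal{F}_t=\{\lambda\in\mathcal{M}(I_{2t})_{\ge 0}:\ \lambda(\{\emptyset\})=1,\ A_t^*\lambda\in\mathcal{M}(I_t\times I_t)_{\succeq 0}\}. \] Proposition. Put $I=I_{\alpha(G)}=I_{2\alpha(G)}$, the set of all independent sets of $G$, and for $R\in I$ let $\chi_R=\sum_{Q\subseteq R}\delta_Q$, where $\delta_Q$ is the point mass at $Q$. Then the extreme points of the feasible region $\mathcal{F}_{\alpha(G)}$ of $\mathrm{las}_{\alpha(G)}(G)$ are precisely the measures $\chi_R$ with $R\in I$. -/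

import Mathlib

open MeasureTheory

noncomputable section

namespace PackingGraph

/-! ### Topological packing graphs -/

/-- Every finite clique is contained in an open clique. (The Hausdorff condition on the vertex set
is carried by the instance `T2Space V` where this is used.) -/
def IsTopologicalPackingGraph {V : Type*} [TopologicalSpace V] (G : SimpleGraph V) : Prop :=
  ∀ C : Finset V, G.IsClique (C : Set V) →
    ∃ U : Set V, IsOpen U ∧ (C : Set V) ⊆ U ∧ G.IsClique U

/-! ### The spaces of subsets and of independent sets of bounded size -/

/-- The collection `sub_t(V)` of subsets of `V` with at most `t` elements. -/
def Sub (V : Type*) (t : ℕ) : Type _ := {S : Finset V // S.card ≤ t}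

open Classical in
/-- The map `V^t → sub_t(V)`, `(v₁, …, v_t) ↦ {v₁, …, v_t}`, together with an additional isolated
point that is sent to the empty set. -/
def Sub.mk' (V : Type*) (t : ℕ) : Unit ⊕ (Fin t → V) → Sub V t
  | Sum.inl _ => ⟨∅, by simp⟩
  | Sum.inr v => ⟨Finset.univ.image v, Finset.card_image_le.trans (by simp)⟩

/-- The quotient topology of the product topology on `V^t`, with the empty set added by a disjoint
union. -/
instance (V : Type*) [TopologicalSpace V] (t : ℕ) : TopologicalSpace (Sub V t) :=
  TopologicalSpace.coinduced (Sub.mk' V t) inferInstance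

/-- The set `I_t` of independent sets with at most `t` elements. -/
def Indep {V : Type*} (G : SimpleGraph V) (t : ℕ) : Type _ :=
  {S : Sub V t // G.IsIndepSet (S.1 : Set V)}

/-- `I_t` carries the subspace topology of `sub_t(V)`. -/
instance {V : Type*} [TopologicalSpace V] (G : SimpleGraph V) (t : ℕ) :
    TopologicalSpace (Indep G t) :=
  inferInstanceAs (TopologicalSpace {S : Sub V t // G.IsIndepSet (S.1 : Set V)})

/-- The underlying finite set of vertices of an element of `I_t`. -/
def Indep.verts {V : Type*} {G : SimpleGraph V} {t : ℕ} (S : Indep G t) : Finset V := S.1.1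

/-- The empty set as an element of `I_t`. -/
def Indep.empty {V : Type*} (G : SimpleGraph V) (t : ℕ) : Indep G t :=
  ⟨⟨∅, by simp⟩, by simp⟩

theorem Indep.verts_injective {V : Type*} (G : SimpleGraph V) (t : ℕ) :
    Function.Injective (Indep.verts : Indep G t → Finset V) :=
  fun _ _ h => Subtype.ext (Subtype.ext h)

theorem Indep.finite_subsets {V : Type*} (G : SimpleGraph V) (t : ℕ) (R : Finset V) :
    {Q : Indep G t | Q.verts ⊆ R}.Finite :=
  Set.Finite.of_finite_image
    (R.powerset.finite_toSet.subset (by rintro _ ⟨Q, hQ, rfl⟩; simpa using hQ))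
    (Indep.verts_injective G t).injOn

theorem Indep.finite_pairs {V : Type*} (G : SimpleGraph V) (t : ℕ) (S : Finset V) :
    {p : Indep G t × Indep G t | (p.1.verts : Set V) ∪ (p.2.verts : Set V) = (S : Set V)}.Finite :=
  ((Indep.finite_subsets G t S).prod (Indep.finite_subsets G t S)).subset (by
    rintro ⟨J, J'⟩ h
    have h' : (J.verts : Set V) ∪ (J'.verts : Set V) = (S : Set V) := h
    exact ⟨Finset.coe_subset.1 (h' ▸ Set.subset_union_left),
      Finset.coe_subset.1 (h' ▸ Set.subset_union_right)⟩)

/-! ### Signed Radon measures -/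

/-- Finite signed measures on the Borel σ-algebra of `X`. -/
abbrev BorelSignedMeasure (X : Type*) [TopologicalSpace X] : Type _ := @SignedMeasure X (borel X)

/-- The pairing `⟨f, μ⟩ = μ(f) = ∫ f dμ`. -/
def pairing {X : Type*} [TopologicalSpace X] (f : X → ℝ) (μ : BorelSignedMeasure X) : ℝ :=
  ∫ᵛ x, f x ∂<•μ

/-- A signed Radon measure is the difference of two Radon measures, that is of two Borel measures
that are inner regular with respect to compact sets and locally finite; on a compact space locally
finite means finite. -/
def IsSignedRadon {X : Type*} [TopologicalSpace X] (μ : BorelSignedMeasure X) : Prop :=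
  letI : MeasurableSpace X := borel X
  ∃ (ν₁ ν₂ : Measure X) (_ : IsFiniteMeasure ν₁) (_ : IsFiniteMeasure ν₂),
    ν₁.InnerRegular ∧ ν₂.InnerRegular ∧ μ = ν₁.toSignedMeasure - ν₂.toSignedMeasure

/-- The cone `M(X)_{≥ 0}` of positive Radon measures: the signed Radon measures that are
nonnegative on all nonnegative continuous functions. -/
def positiveRadon (X : Type*) [TopologicalSpace X] : Set (BorelSignedMeasure X) :=
  {μ | IsSignedRadon μ ∧ ∀ f : C(X, ℝ), (∀ x, 0 ≤ f x) → 0 ≤ pairing f μ}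

/-- The delta measure at a point. -/
def delta {X : Type*} [TopologicalSpace X] (x : X) : BorelSignedMeasure X :=
  letI : MeasurableSpace X := borel X
  VectorMeasure.dirac x (1 : ℝ)

/-! ### Symmetric kernels and symmetric measures -/

/-- The space `C(X × X)_sym` of symmetric continuous kernels. -/
def symKernels (X : Type*) [TopologicalSpace X] : Set C(X × X, ℝ) :=
  {K | ∀ x y, K (x, y) = K (y, x)}

/-- The cone `C(X × X)_{⪰ 0}` of positive definite kernels. -/
def posDefKernels (X : Type*) [TopologicalSpace X] : Set C(X × X, ℝ) :=
  {K | K ∈ symKernels X ∧ ∀ (m : ℕ) (x : Fin m → X),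
    (Matrix.of fun i j : Fin m => K (x i, x j)).PosSemidef}

/-- The space `M(X × X)_sym` of symmetric signed Radon measures. -/
def symMeasures (X : Type*) [TopologicalSpace X] : Set (BorelSignedMeasure (X × X)) :=
  {μ | IsSignedRadon μ ∧ ∀ E E' : Set X, MeasurableSet[borel X] E → MeasurableSet[borel X] E' →
    μ (E ×ˢ E') = μ (E' ×ˢ E)}

/-- The cone `M(X × X)_{⪰ 0}` of positive definite measures, the dual cone of
`C(X × X)_{⪰ 0}`. -/
def posDefMeasures (X : Type*) [TopologicalSpace X] : Set (BorelSignedMeasure (X × X)) :=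
  {μ | μ ∈ symMeasures X ∧ ∀ K ∈ posDefKernels X, 0 ≤ pairing K μ}

/-! ### The hierarchy -/

section Hierarchy

variable {V : Type*} [TopologicalSpace V] (G : SimpleGraph V) (t : ℕ)

/-- `A_t K (S) = ∑_{J, J' ∈ I_t, J ∪ J' = S} K(J, J')` for `S ∈ I_{2t}`. -/
def opA (K : C(Indep G t × Indep G t, ℝ)) (S : Indep G (2 * t)) : ℝ :=
  ∑ p ∈ (Indep.finite_pairs G t S.verts).toFinset, K p

/-- `μ = A_t^* lam`: the symmetric signed Radon measure `μ` on `I_t × I_t` with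
`⟨K, μ⟩ = ⟨A_t K, lam⟩` for all symmetric kernels `K`. -/
def IsAdjointImage (lam : BorelSignedMeasure (Indep G (2 * t)))
    (μ : BorelSignedMeasure (Indep G t × Indep G t)) : Prop :=
  μ ∈ symMeasures (Indep G t) ∧
    ∀ K ∈ symKernels (Indep G t), pairing K μ = pairing (opA G t K) lam

/-- The feasible region of `las_t(G)`: the positive Radon measures `lam` on `I_{2t}` with
`lam({∅}) = 1` whose image `A_t^* lam` is positive definite. -/
def feasibleRegion : Set (BorelSignedMeasure (Indep G (2 * t))) :=
  {lam | lam ∈ positiveRadon (Indep G (2 * t)) ∧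
    lam {Indep.empty G (2 * t)} = 1 ∧
    ∃ μ, IsAdjointImage G t lam μ ∧ μ ∈ posDefMeasures (Indep G t)}

/-- `χ_R = ∑_{Q ⊆ R} δ_Q`, as a measure on `I_{2t}`, for `R ∈ I_t`. -/
def chi (R : Indep G t) : BorelSignedMeasure (Indep G (2 * t)) :=
  ∑ Q ∈ (Indep.finite_subsets G (2 * t) R.verts).toFinset, delta Q

end Hierarchy

end PackingGraph

end

noncomputable section

namespace PackingGraph

/-! ### Integration against signed Radon measures -/

section Radon

variable {X : Type*} [TopologicalSpace X]

/-! Let `I` be the space of all independent sets. Every subset of an independent set is independent,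
so Möbius inversion makes the zeta transform `f ↦ (R ↦ ∑_{Q ⊆ R} f Q)` a bijection of `C(I)` with
inverse `mob`; that both preserve continuity is the topological input (`exists_local_subsets`): near
`S₀` an independent set has as many elements as `S₀`, and its subsets move continuously with those
of `S₀`.

Put `σ(f) = ⟨mob f, λ⟩`, so that `⟨f, λ⟩ = σ(zeta f)`. Grouping pairs `(J, J')` by their union gives
`⟨A K, λ⟩ = σ(doubleZeta K)`. For `K = h ⊗ h` with `h = mob g` this is `σ(g²)`, so positive
definiteness of `A^* λ` forces `σ ≥ 0`; conversely `doubleZeta K` is pointwise nonnegative for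
positive definite `K`. Since `mob 1` is the indicator of the empty set, `λ({∅}) = 1` means `σ(1) =
1`.

Hence the feasible measures correspond affinely to the normalized positive functionals (states) on
`C(I)`. Extreme states are multiplicative and so are point evaluations, and evaluation at `R`
corresponds to `⟨f, λ⟩ = ∑_{Q ⊆ R} f Q`, that is `λ = χ_R`. -/

theorem pairing_toSignedMeasure (f : X → ℝ) (ν : @Measure X (borel X))
    [@IsFiniteMeasure X (borel X) ν] :
    pairing f (@Measure.toSignedMeasure X (borel X) ν _) =
      @integral X ℝ _ _ (borel X) ν f := by
  let _ : MeasurableSpace X := borel X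
  exact VectorMeasure.integral_toSignedMeasure

theorem integrable_of_compactSpace [CompactSpace X] [MeasurableSpace X] [BorelSpace X]
    (f : C(X, ℝ)) (ν : Measure X) [IsFiniteMeasure ν] : Integrable f ν :=
  (BoundedContinuousFunction.mkOfCompact f).integrable ν

theorem IsSignedRadon.integrable [CompactSpace X] {μ : BorelSignedMeasure X}
    (hμ : IsSignedRadon μ) (f : C(X, ℝ)) :
    @VectorMeasure.Integrable _ _ _ (borel X) _ _ μ f := by
  let _ : MeasurableSpace X := borel X
  have _ : BorelSpace X := ⟨rfl⟩
  obtain ⟨ν₁, ν₂, _, _, -, -, rfl⟩ := hμ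
  apply VectorMeasure.Integrable.sub_vectorMeasure
  · simpa [VectorMeasure.Integrable] using integrable_of_compactSpace f ν₁
  · simpa [VectorMeasure.Integrable] using integrable_of_compactSpace f ν₂

theorem IsSignedRadon.pairing_add [CompactSpace X] {μ : BorelSignedMeasure X}
    (hμ : IsSignedRadon μ) (f g : C(X, ℝ)) :
    pairing (f + g : C(X, ℝ)) μ = pairing f μ + pairing g μ := by
  let _ : MeasurableSpace X := borel X
  exact VectorMeasure.integral_add (hμ.integrable f) (hμ.integrable g)

theorem pairing_smul (c : ℝ) (f : C(X, ℝ)) (μ : BorelSignedMeasure X) :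
    pairing (c • f : C(X, ℝ)) μ = c * pairing f μ := by
  let _ : MeasurableSpace X := borel X
  exact VectorMeasure.integral_fun_smul _ _ c (f : X → ℝ)

theorem pairing_combination [CompactSpace X] {μ ν : BorelSignedMeasure X}
    (hμ : IsSignedRadon μ) (hν : IsSignedRadon ν) (a b : ℝ) (f : C(X, ℝ)) :
    pairing f (a • μ + b • ν) = a * pairing f μ + b * pairing f ν := by
  let _ : MeasurableSpace X := borel X
  unfold pairing
  rw [VectorMeasure.integral_add_vectorMeasure ((hμ.integrable f).smul_vectorMeasure a)
    ((hν.integrable f).smul_vectorMeasure b), VectorMeasure.integral_smul_vectorMeasure,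
    VectorMeasure.integral_smul_vectorMeasure, smul_eq_mul, smul_eq_mul]

theorem integral_toSignedMeasure_sub [CompactSpace X] [MeasurableSpace X]
    [BorelSpace X] (f : C(X, ℝ)) (ν₁ ν₂ : Measure X) [IsFiniteMeasure ν₁] [IsFiniteMeasure ν₂] :
    VectorMeasure.integral (ν₁.toSignedMeasure - ν₂.toSignedMeasure) f
      (ContinuousLinearMap.lsmul ℝ ℝ).flip = ∫ x, f x ∂ν₁ - ∫ x, f x ∂ν₂ := by
  rw [VectorMeasure.integral_sub_vectorMeasure, VectorMeasure.integral_toSignedMeasure,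
    VectorMeasure.integral_toSignedMeasure]
  · simpa [VectorMeasure.Integrable] using integrable_of_compactSpace f ν₁
  · simpa [VectorMeasure.Integrable] using integrable_of_compactSpace f ν₂

theorem measure_ext_of_integral [CompactSpace X] [T2Space X] [MeasurableSpace X]
    [BorelSpace X] {μ ν : Measure X} [IsFiniteMeasure μ] [IsFiniteMeasure ν]
    [μ.InnerRegular] [ν.InnerRegular] (h : ∀ f : C(X, ℝ), ∫ x, f x ∂μ = ∫ x, f x ∂ν) : μ = ν :=
  Measure.ext_of_integral_eq_on_compactlySupported fun f => h f.toContinuousMap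

/-- A signed Radon measure on a compact Hausdorff space is determined by the integrals of the
continuous functions. -/
theorem IsSignedRadon.ext [CompactSpace X] [T2Space X] {μ ν : BorelSignedMeasure X}
    (hμ : IsSignedRadon μ) (hν : IsSignedRadon ν)
    (h : ∀ f : C(X, ℝ), pairing f μ = pairing f ν) : μ = ν := by
  let _ : MeasurableSpace X := borel X
  have _ : BorelSpace X := ⟨rfl⟩
  obtain ⟨μ₁, μ₂, _, _, _, _, rfl⟩ := hμ
  obtain ⟨ν₁, ν₂, _, _, _, _, rfl⟩ := hν
  -- Moving the negative parts across reduces the claim to uniqueness for positive inner regular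
  -- measures.
  have key : μ₁ + ν₂ = ν₁ + μ₂ := by
    refine measure_ext_of_integral fun f => ?_
    rw [integral_add_measure (integrable_of_compactSpace f _) (integrable_of_compactSpace f _),
      integral_add_measure (integrable_of_compactSpace f _) (integrable_of_compactSpace f _)]
    have := h f
    unfold pairing at this
    rw [integral_toSignedMeasure_sub,
      integral_toSignedMeasure_sub] at this
    linarith
  have := Measure.toSignedMeasure_congr key
  rw [Measure.toSignedMeasure_add, Measure.toSignedMeasure_add] at this
  rw [sub_eq_sub_iff_add_eq_add, this]

/-- The Riesz representation theorem on a compact Hausdorff space. -/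
theorem exists_measure_of_positive [CompactSpace X] [T2Space X] [MeasurableSpace X] [BorelSpace X]
    (Λ : C(X, ℝ) →ₗ[ℝ] ℝ) (hΛ : ∀ f : C(X, ℝ), (∀ x, 0 ≤ f x) → 0 ≤ Λ f) :
    ∃ (ν : Measure X) (_ : IsFiniteMeasure ν), ν.InnerRegular ∧
      ∀ f : C(X, ℝ), ∫ x, f x ∂ν = Λ f := by
  let T : CompactlySupportedContinuousMap X ℝ →ₗ[ℝ] ℝ :=
    { toFun := fun f => Λ f.toContinuousMap
      map_add' := fun f g => Λ.map_add f.toContinuousMap g.toContinuousMap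
      map_smul' := fun c f => Λ.map_smul c f.toContinuousMap }
  let Λ' : CompactlySupportedContinuousMap X ℝ →ₚ[ℝ] ℝ :=
    PositiveLinearMap.mk₀ T fun f hf => hΛ _ fun x => hf x
  refine ⟨RealRMK.rieszMeasure Λ', inferInstance, inferInstance, fun f => ?_⟩
  exact RealRMK.integral_rieszMeasure Λ' ⟨f, HasCompactSupport.of_compactSpace _⟩

theorem isSignedRadon_toSignedMeasure (ν : @Measure X (borel X))
    [@IsFiniteMeasure X (borel X) ν] (hν : @Measure.InnerRegular X (borel X) _ ν) :
    IsSignedRadon (@Measure.toSignedMeasure X (borel X) ν _) := by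
  let _ : MeasurableSpace X := borel X
  exact ⟨ν, 0, inferInstance, inferInstance, hν, inferInstance, by simp⟩

theorem exists_positiveRadon_of_positive [CompactSpace X] [T2Space X]
    (Λ : C(X, ℝ) →ₗ[ℝ] ℝ) (hΛ : ∀ f : C(X, ℝ), (∀ x, 0 ≤ f x) → 0 ≤ Λ f) :
    ∃ μ ∈ positiveRadon X, ∀ f : C(X, ℝ), pairing f μ = Λ f := by
  let _ : MeasurableSpace X := borel X
  have _ : BorelSpace X := ⟨rfl⟩
  obtain ⟨ν, _, hν, h⟩ := exists_measure_of_positive Λ hΛ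
  have hp : ∀ f : C(X, ℝ), pairing f ν.toSignedMeasure = Λ f := fun f =>
    (pairing_toSignedMeasure f ν).trans (h f)
  exact ⟨ν.toSignedMeasure, ⟨isSignedRadon_toSignedMeasure ν hν, fun f hf => by
    rw [hp]; exact hΛ f hf⟩, hp⟩

theorem exists_symMeasure_of_positive [CompactSpace X] [T2Space X]
    (Λ : C(X × X, ℝ) →ₗ[ℝ] ℝ) (hΛ : ∀ f : C(X × X, ℝ), (∀ x, 0 ≤ f x) → 0 ≤ Λ f)
    (hsymm : ∀ f : C(X × X, ℝ), Λ (f.comp (Homeomorph.prodComm X X)) = Λ f) :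
    ∃ μ ∈ symMeasures X, ∀ f : C(X × X, ℝ), pairing f μ = Λ f := by
  let _ : MeasurableSpace (X × X) := borel (X × X)
  have _ : BorelSpace (X × X) := ⟨rfl⟩
  obtain ⟨ν, _, hν, h⟩ := exists_measure_of_positive Λ hΛ
  have hmeas : Measurable (Homeomorph.prodComm X X) := (Homeomorph.prodComm X X).measurable
  have hfin : IsFiniteMeasure (ν.map (Homeomorph.prodComm X X)) := Measure.isFiniteMeasure_map _ _
  have hreg : (ν.map (Homeomorph.prodComm X X)).InnerRegular := by
    have := Measure.Regular.map (μ := ν) (Homeomorph.prodComm X X)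
    infer_instance
  -- The pushforward under the swap is again inner regular and has the same integrals, so uniqueness
  -- turns symmetry of the functional into symmetry of the measure.
  have hmap : ν.map (Homeomorph.prodComm X X) = ν := by
    refine measure_ext_of_integral fun f => ?_
    rw [integral_map hmeas.aemeasurable f.continuous.aestronglyMeasurable, h f, ← hsymm f, ← h]
    rfl
  refine ⟨ν.toSignedMeasure, ⟨isSignedRadon_toSignedMeasure ν hν, fun E E' hE hE' => ?_⟩,
    fun f => (pairing_toSignedMeasure f ν).trans (h f)⟩
  -- Without second countability the Borel σ-algebra of `X × X` may exceed the product one; only the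
  -- easy inclusion, from continuity of the projections, is needed.
  have hprod : ∀ {A B : Set X}, MeasurableSet[borel X] A → MeasurableSet[borel X] B →
      MeasurableSet (A ×ˢ B) := by
    intro A B hA hB
    let _ : MeasurableSpace X := borel X
    have _ : BorelSpace X := ⟨rfl⟩
    exact (continuous_fst.measurable hA).inter (continuous_snd.measurable hB)
  rw [Measure.toSignedMeasure_apply_measurable (hprod hE hE'),
    Measure.toSignedMeasure_apply_measurable (hprod hE' hE)]
  conv_lhs => rw [← hmap]
  rw [map_measureReal_apply hmeas (hprod hE hE')]
  congr 1
  ext ⟨x, y⟩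
  simp [and_comm]

theorem isSignedRadon_delta [T2Space X] (x : X) : IsSignedRadon (delta x) := by
  let _ : MeasurableSpace X := borel X
  have _ : BorelSpace X := ⟨rfl⟩
  refine ⟨Measure.dirac x, 0, inferInstance, inferInstance, ⟨fun A hA r hr => ?_⟩,
    inferInstance, ?_⟩
  · by_cases hx : x ∈ A
    · refine ⟨{x}, by simpa using hx, isCompact_singleton, ?_⟩
      simpa [Measure.dirac_apply' _ hA, hx] using hr
    · simp [Measure.dirac_apply' _ hA, hx] at hr
  · ext s hs
    by_cases hx : x ∈ s
    · simp [delta, hx, hs, Measure.real]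
    · simp [delta, hx, hs, Measure.real]

theorem isSignedRadon_sum {ι : Type*} (s : Finset ι) (μ : ι → BorelSignedMeasure X)
    (h : ∀ i ∈ s, IsSignedRadon (μ i)) : IsSignedRadon (∑ i ∈ s, μ i) := by
  let _ : MeasurableSpace X := borel X
  classical
  induction s using Finset.induction_on with
  | empty => exact ⟨0, 0, inferInstance, inferInstance, inferInstance, inferInstance, by simp⟩
  | insert i s hi ih =>
    obtain ⟨μ₁, μ₂, _, _, _, _, h₁⟩ := h i (Finset.mem_insert_self i s)
    obtain ⟨ν₁, ν₂, _, _, _, _, h₂⟩ := ih fun j hj => h j (Finset.mem_insert_of_mem hj)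
    refine ⟨μ₁ + ν₁, μ₂ + ν₂, inferInstance, inferInstance, inferInstance, inferInstance, ?_⟩
    rw [Finset.sum_insert hi, h₁, h₂, Measure.toSignedMeasure_add, Measure.toSignedMeasure_add]
    abel

theorem IsSignedRadon.smul_of_nonneg {μ : BorelSignedMeasure X}
    (hμ : IsSignedRadon μ) {a : ℝ} (ha : 0 ≤ a) : IsSignedRadon (a • μ) := by
  let _ : MeasurableSpace X := borel X
  lift a to NNReal using ha
  obtain ⟨ν₁, ν₂, _, _, _, _, rfl⟩ := hμ
  refine ⟨a • ν₁, a • ν₂, inferInstance, inferInstance, inferInstance, inferInstance, ?_⟩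
  rw [Measure.toSignedMeasure_smul, Measure.toSignedMeasure_smul, smul_sub]
  rfl

theorem IsSignedRadon.add {μ ν : BorelSignedMeasure X}
    (hμ : IsSignedRadon μ) (hν : IsSignedRadon ν) : IsSignedRadon (μ + ν) := by
  have := isSignedRadon_sum Finset.univ ![μ, ν] (by simp [Fin.forall_fin_two, hμ, hν])
  simpa using this

theorem pairing_sum_delta [CompactSpace X] [T2Space X] (s : Finset X) (f : C(X, ℝ)) :
    pairing f (∑ x ∈ s, delta x) = ∑ x ∈ s, f x := by
  let _ : MeasurableSpace X := borel X
  have _ : BorelSpace X := ⟨rfl⟩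
  unfold pairing
  rw [VectorMeasure.integral_finsetSum_vectorMeasure
    fun x _ => (isSignedRadon_delta x).integrable f]
  refine Finset.sum_congr rfl fun x _ => ?_
  exact (VectorMeasure.integral_dirac' f.continuous.stronglyMeasurable).trans (by simp)

/-- Such an `f` is the indicator of `{x}`. It turns the normalization at the empty set into a
condition on integrals of continuous functions. -/
theorem IsSignedRadon.pairing_eq_apply_singleton [CompactSpace X] [T2Space X]
    {μ : BorelSignedMeasure X} (hμ : IsSignedRadon μ) {x : X} (f : C(X, ℝ)) (hx : f x = 1)
    (hf : ∀ y, y ≠ x → f y = 0) : pairing f μ = μ {x} := by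
  let _ : MeasurableSpace X := borel X
  have _ : BorelSpace X := ⟨rfl⟩
  have hfx : (f : X → ℝ) = Set.indicator {x} fun _ => 1 := by
    ext y
    by_cases hy : y = x
    · simp [hy, hx]
    · simp [hy, hf y hy]
  obtain ⟨ν₁, ν₂, _, _, _, _, rfl⟩ := hμ
  unfold pairing
  rw [integral_toSignedMeasure_sub, hfx,
    integral_indicator_const _ (measurableSet_singleton x),
    integral_indicator_const _ (measurableSet_singleton x),
    Measure.toSignedMeasure_sub_apply (measurableSet_singleton x)]
  simp

end Radon

/-! ### The topology of the spaces of bounded subsets and of independent sets -/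

section Topology

open Filter Topology

variable {V : Type*}

theorem exists_image_univ_eq [DecidableEq V] {A : Finset V} (hA : A.Nonempty) {t : ℕ}
    (ht : A.card ≤ t) : ∃ a : Fin t → V, Finset.univ.image a = A := by
  obtain ⟨x, hx⟩ := hA
  -- Enumerate `A`, then fill the remaining coordinates with repetitions of `x`.
  refine ⟨fun i => if h : (i : ℕ) < A.card then (A.equivFin.symm ⟨i, h⟩ : V) else x, ?_⟩
  ext y
  simp only [Finset.mem_image, Finset.mem_univ, true_and]
  constructor
  · rintro ⟨i, rfl⟩
    split_ifs
    · exact Subtype.coe_prop _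
    · exact hx
  · intro hy
    refine ⟨⟨A.equivFin ⟨y, hy⟩, (Fin.is_lt _).trans_le ht⟩, ?_⟩
    simp

theorem Sub.mk'_surjective (t : ℕ) : Function.Surjective (Sub.mk' V t) := by
  classical
  rintro ⟨S, hS⟩
  rcases S.eq_empty_or_nonempty with rfl | hne
  · exact ⟨Sum.inl (), rfl⟩
  · obtain ⟨a, ha⟩ := exists_image_univ_eq hne hS
    refine ⟨Sum.inr a, Subtype.ext ?_⟩
    refine Eq.trans ?_ ha
    simp only [Sub.mk']

theorem Sub.mem_mk'_inr {t : ℕ} (v : Fin t → V) (x : V) :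
    x ∈ (Sub.mk' V t (Sum.inr v)).1 ↔ ∃ i, v i = x := by
  simp [Sub.mk']

variable {G : SimpleGraph V}

theorem eq_of_isClique_of_isIndepSet {U S : Set V} (hU : G.IsClique U) (hS : G.IsIndepSet S)
    {x y : V} (hxU : x ∈ U) (hyU : y ∈ U) (hxS : x ∈ S) (hyS : y ∈ S) : x = y := by
  by_contra h
  exact hS hxS hyS h (hU hxU hyU h)

theorem Indep.isIndepSet {t : ℕ} (S : Indep G t) : G.IsIndepSet (S.verts : Set V) := S.2

variable [TopologicalSpace V]

theorem Sub.continuous_mk' (t : ℕ) : Continuous (Sub.mk' V t) := continuous_coinduced_rng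

theorem Sub.isOpen_hits (t : ℕ) {U : Set V} (hU : IsOpen U) :
    IsOpen {S : Sub V t | ∃ x ∈ S.1, x ∈ U} := by
  rw [isOpen_coinduced, isOpen_sum_iff]
  refine ⟨isOpen_discrete _, ?_⟩
  have : Sum.inr ⁻¹' (Sub.mk' V t ⁻¹' {S : Sub V t | ∃ x ∈ S.1, x ∈ U}) =
      ⋃ i, {v : Fin t → V | v i ∈ U} := by
    ext v
    simp [Sub.mk']
  rw [this]
  exact isOpen_iUnion fun i => hU.preimage (continuous_apply i)

theorem Sub.isOpen_within (t : ℕ) {U : Set V} (hU : IsOpen U) :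
    IsOpen {S : Sub V t | ∀ x ∈ S.1, x ∈ U} := by
  rw [isOpen_coinduced, isOpen_sum_iff]
  refine ⟨isOpen_discrete _, ?_⟩
  have : Sum.inr ⁻¹' (Sub.mk' V t ⁻¹' {S : Sub V t | ∀ x ∈ S.1, x ∈ U}) =
      ⋂ i, {v : Fin t → V | v i ∈ U} := by
    ext v
    simp [Sub.mk']
  rw [this]
  exact isOpen_iInter_of_finite fun i => hU.preimage (continuous_apply i)

instance (t : ℕ) [CompactSpace V] : CompactSpace (Sub V t) :=
  (Sub.mk'_surjective t).compactSpace (Sub.continuous_mk' t)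

/-- If `x ∈ S \ T`, separate `x` from the finite set `T` by disjoint open `U`, `W`: "meets `U`" and
"lies within `W`" are then disjoint open conditions. -/
instance (t : ℕ) [T2Space V] : T2Space (Sub V t) := by
  have key : ∀ S T : Sub V t, ¬ S.1 ⊆ T.1 →
      ∃ u v : Set (Sub V t), IsOpen u ∧ IsOpen v ∧ S ∈ u ∧ T ∈ v ∧ Disjoint u v := by
    intro S T h
    obtain ⟨x, hxS, hxT⟩ := Finset.not_subset.1 h
    obtain ⟨U, W, hU, hW, hxU, hTW, hUW⟩ := SeparatedNhds.of_isCompact_isCompact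
      (isCompact_singleton (x := x)) T.1.finite_toSet.isCompact
      (Set.disjoint_singleton_left.2 (by simpa using hxT))
    refine ⟨_, _, Sub.isOpen_hits t hU, Sub.isOpen_within t hW, ⟨x, hxS, hxU rfl⟩,
      fun y hy => hTW hy, Set.disjoint_left.2 ?_⟩
    rintro R ⟨y, hy, hyU⟩ hR
    exact Set.disjoint_left.1 hUW hyU (hR y hy)
  refine ⟨fun S T hST => ?_⟩
  by_cases h : S.1 ⊆ T.1
  · obtain ⟨u, v, hu, hv, hTu, hSv, huv⟩ :=
      key T S fun h' => hST (Subtype.ext (h.antisymm h'))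
    exact ⟨v, u, hv, hu, hSv, hTu, huv.symm⟩
  · exact key S T h

/-- The edge `{x, y}` lies in an open clique; cutting it with disjoint neighbourhoods rules out
equal vertices, so adjacency is an open relation. -/
theorem IsTopologicalPackingGraph.exists_adj_nhds [T2Space V] (hG : IsTopologicalPackingGraph G)
    {x y : V} (hxy : G.Adj x y) : ∃ U W : Set V, IsOpen U ∧ IsOpen W ∧ x ∈ U ∧ y ∈ W ∧
      ∀ u ∈ U, ∀ w ∈ W, G.Adj u w := by
  classical
  obtain ⟨C, hC, hxC, hclique⟩ := hG {x, y} (by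
    simpa [SimpleGraph.isClique_iff, Set.pairwise_insert] using
      fun _ => ⟨hxy, hxy.symm⟩)
  obtain ⟨U, W, hU, hW, hxU, hyW, hUW⟩ := t2_separation hxy.ne
  refine ⟨U ∩ C, W ∩ C, hU.inter hC, hW.inter hC, ⟨hxU, hxC (by simp)⟩, ⟨hyW, hxC (by simp)⟩, ?_⟩
  rintro u ⟨huU, huC⟩ w ⟨hwW, hwC⟩
  exact hclique huC hwC fun h => Set.disjoint_left.1 hUW huU (h ▸ hwW)

theorem IsTopologicalPackingGraph.exists_open_clique (hG : IsTopologicalPackingGraph G) (x : V) :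
    ∃ U : Set V, IsOpen U ∧ x ∈ U ∧ G.IsClique U := by
  obtain ⟨U, hU, hxU, hc⟩ := hG {x} (by simp)
  exact ⟨U, hU, hxU (by simp), hc⟩

theorem IsTopologicalPackingGraph.isClosed_indep [T2Space V] (hG : IsTopologicalPackingGraph G)
    (t : ℕ) : IsClosed {S : Sub V t | G.IsIndepSet (S.1 : Set V)} := by
  rw [← isOpen_compl_iff, isOpen_iff_forall_mem_open]
  intro S hS
  obtain ⟨x, hx, y, hy, -, hxy⟩ : ∃ x ∈ S.1, ∃ y ∈ S.1, x ≠ y ∧ G.Adj x y := by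
    simpa [SimpleGraph.isIndepSet_iff, Set.Pairwise] using hS
  obtain ⟨U, W, hU, hW, hxU, hyW, h⟩ := hG.exists_adj_nhds hxy
  refine ⟨_, ?_, (Sub.isOpen_hits t hU).inter (Sub.isOpen_hits t hW),
    ⟨⟨x, hx, hxU⟩, ⟨y, hy, hyW⟩⟩⟩
  rintro R ⟨⟨u, hu, huU⟩, ⟨w, hw, hwW⟩⟩ hR
  exact hR hu hw (h u huU w hwW).ne (h u huU w hwW)

theorem IsTopologicalPackingGraph.compactSpace_indep [T2Space V] [CompactSpace V]
    (hG : IsTopologicalPackingGraph G) (t : ℕ) : CompactSpace (Indep G t) :=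
  isCompact_iff_compactSpace.1 (hG.isClosed_indep t).isCompact

instance [T2Space V] (t : ℕ) : T2Space (Indep G t) :=
  inferInstanceAs (T2Space {S : Sub V t // G.IsIndepSet (S.1 : Set V)})

/-- The independence number of a compact topological packing graph is finite. -/
theorem IsTopologicalPackingGraph.card_le_indepNum [CompactSpace V]
    (hG : IsTopologicalPackingGraph G) {S : Finset V} (hS : G.IsIndepSet (S : Set V)) :
    S.card ≤ G.indepNum := by
  choose U hU hxU hc using hG.exists_open_clique
  obtain ⟨F, hF⟩ := isCompact_univ.elim_finite_subcover U hU
    fun x _ => Set.mem_iUnion.2 ⟨x, hxU x⟩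
  refine le_csSup ⟨F.card, ?_⟩ ⟨S, hS, rfl⟩
  rintro n ⟨T, hT, rfl⟩
  have hcov : ∀ x, ∃ y ∈ F, x ∈ U y := fun x => by simpa using hF (Set.mem_univ x)
  -- Sending a vertex to a covering clique containing it is injective on an independent set, which
  -- meets each clique at most once.
  choose f hfF hf using hcov
  refine Finset.card_le_card_of_injOn f (fun x _ => hfF x) fun x hx y hy hxy => ?_
  exact eq_of_isClique_of_isIndepSet (hc (f x)) hT (hf x) (hxy ▸ hf y) hx hy

theorem Indep.isOpen_hits (t : ℕ) {U : Set V} (hU : IsOpen U) :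
    IsOpen {S : Indep G t | ∃ x ∈ S.verts, x ∈ U} :=
  (Sub.isOpen_hits t hU).preimage continuous_subtype_val

theorem Indep.isOpen_within (t : ℕ) {U : Set V} (hU : IsOpen U) :
    IsOpen {S : Indep G t | ∀ x ∈ S.verts, x ∈ U} :=
  (Sub.isOpen_within t hU).preimage continuous_subtype_val

/-- Near an independent set `S₀`, the independent sets are parametrized by the vertices of `S₀`. -/
theorem IsTopologicalPackingGraph.exists_local_section [T2Space V] [DecidableEq V]
    (hG : IsTopologicalPackingGraph G) {t : ℕ} (S₀ : Indep G t) :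
    ∃ p : V → Indep G t → V, (∀ x ∈ S₀.verts, Tendsto (p x) (𝓝 S₀) (𝓝 x)) ∧
      ∀ᶠ S in 𝓝 S₀, S.verts = S₀.verts.image (p · S) ∧
        Set.InjOn (p · S) (S₀.verts : Set V) := by
  classical
  obtain ⟨D, hD, hdisj⟩ := S₀.verts.finite_toSet.t2_separation
  choose C hC using hG.exists_open_clique
  -- Inside the clique `C x` an independent set has at most one vertex; disjointness of the `D x`
  -- keeps the vertices for different `x` apart.
  let U : V → Set V := fun x => D x ∩ C x
  have hU : ∀ x, IsOpen (U x) := fun x => (hD x).2.inter (hC x).1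
  have hxU : ∀ x, x ∈ U x := fun x => ⟨(hD x).1, (hC x).2.1⟩
  have huniq : ∀ {x y z : V} {S : Indep G t}, y ∈ S.verts → z ∈ S.verts → y ∈ U x → z ∈ U x →
      y = z := fun {x y z S} hy hz hyU hzU =>
    eq_of_isClique_of_isIndepSet (hC x).2.2 S.isIndepSet hyU.2 hzU.2 hy hz
  -- `p x S` is the unique vertex of `S` in `U x`; the default `x` is never met for `S` near `S₀`
  -- and `x ∈ S₀`.
  let p : V → Indep G t → V := fun x S =>
    if h : ∃ y ∈ S.verts, y ∈ U x then h.choose else x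
  have hp : ∀ {x : V} {S : Indep G t}, (∃ y ∈ S.verts, y ∈ U x) →
      p x S ∈ S.verts ∧ p x S ∈ U x := by
    intro x S h
    simp only [p, dif_pos h]
    exact h.choose_spec
  refine ⟨p, fun x hx => ?_, ?_⟩
  · rw [tendsto_nhds]
    intro W hW hxW
    refine mem_of_superset ((Indep.isOpen_hits t ((hU x).inter hW)).mem_nhds
      ⟨x, hx, hxU x, hxW⟩) ?_
    rintro S ⟨y, hy, hyU, hyW⟩
    have h := hp ⟨y, hy, hyU⟩
    have : p x S = y := huniq h.1 hy h.2 hyU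
    simpa [this] using hyW
  · have h₁ : ∀ᶠ S in 𝓝 S₀, ∀ x ∈ S₀.verts, ∃ y ∈ S.verts, y ∈ U x :=
      (Finset.eventually_all S₀.verts).2 fun x hx =>
        (Indep.isOpen_hits t (hU x)).mem_nhds ⟨x, hx, hxU x⟩
    have h₂ : ∀ᶠ S in 𝓝 S₀, ∀ y ∈ S.verts, y ∈ ⋃ x ∈ S₀.verts, U x :=
      (Indep.isOpen_within t (isOpen_biUnion fun x _ => hU x)).mem_nhds
        fun x hx => Set.mem_biUnion hx (hxU x)
    filter_upwards [h₁, h₂] with S hS₁ hS₂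
    refine ⟨?_, fun x hx y hy hxy => ?_⟩
    · ext y
      rw [Finset.mem_image]
      constructor
      · intro hy
        obtain ⟨x, hx, hyx⟩ := Set.mem_iUnion₂.1 (hS₂ y hy)
        have h := hp (hS₁ x hx)
        exact ⟨x, hx, huniq h.1 hy h.2 hyx⟩
      · rintro ⟨x, hx, rfl⟩
        exact (hp (hS₁ x hx)).1
    · by_contra hne
      refine Set.disjoint_left.1 (hdisj hx hy hne) (hp (hS₁ x hx)).2.1 ?_
      have : p x S = p y S := hxy
      rw [this]
      exact (hp (hS₁ y hy)).2.1

/-- For nonempty `A`, enumerate it by a tuple in `V^s`: the tuples converge coordinatewise, and the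
quotient map is continuous. For empty `A` the map is eventually constant. -/
theorem Indep.tendsto_of_verts_eq [DecidableEq V] {ι : Type*} {l : Filter ι} {s : ℕ}
    {A : Finset V} {p : V → ι → V} (hp : ∀ x ∈ A, Tendsto (p x) l (𝓝 x)) {g : ι → Indep G s}
    (hg : ∀ᶠ i in l, (g i).verts = A.image (p · i)) {S : Indep G s} (hS : S.verts = A) :
    Tendsto g l (𝓝 S) := by
  rcases A.eq_empty_or_nonempty with rfl | hne
  · refine tendsto_const_nhds.congr' ?_
    filter_upwards [hg] with i hi
    exact Indep.verts_injective G s (by rw [hS, hi, Finset.image_empty])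
  · obtain ⟨a, ha⟩ := exists_image_univ_eq hne (hS.symm ▸ S.1.2 : A.card ≤ s)
    refine tendsto_subtype_rng.2 ?_
    have hval : S.1 = Sub.mk' V s (Sum.inr a) := Subtype.ext <| by
      ext x
      rw [Sub.mem_mk'_inr]
      change x ∈ S.verts ↔ _
      rw [hS, ← ha]
      simp
    rw [hval]
    have hlim : Tendsto (fun i => Sub.mk' V s (Sum.inr fun j => p (a j) i)) l
        (𝓝 (Sub.mk' V s (Sum.inr a))) := by
      refine (((Sub.continuous_mk' s).comp continuous_inr).tendsto a).comp ?_
      exact tendsto_pi_nhds.2 fun j => hp (a j) (ha ▸ Finset.mem_image_of_mem a (Finset.mem_univ j))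
    refine hlim.congr' ?_
    filter_upwards [hg] with i hi
    refine Subtype.ext ?_
    ext x
    rw [Sub.mem_mk'_inr]
    change _ ↔ x ∈ (g i).verts
    rw [hi, ← ha]
    simp

/-- Near an independent set `S₀ ∈ I_t`, the subsets of `S` are parametrized continuously by the
subsets of `S₀`. -/
theorem IsTopologicalPackingGraph.exists_local_subsets [T2Space V]
    (hG : IsTopologicalPackingGraph G) {s t : ℕ}
    (hs : ∀ S : Finset V, G.IsIndepSet (S : Set V) → S.card ≤ s) (S₀ : Indep G t) :
    ∃ g : Finset V → Indep G t → Indep G s,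
      (∀ A ⊆ S₀.verts, ContinuousAt (g A) S₀) ∧
      ∀ᶠ S in 𝓝 S₀, S.verts.card = S₀.verts.card ∧
        ∀ F : Finset V → ℝ, ∑ Q ∈ S.verts.powerset, F Q =
          ∑ A ∈ S₀.verts.powerset, F (g A S).verts := by
  classical
  obtain ⟨p, hp, hev⟩ := hG.exists_local_section S₀
  let g : Finset V → Indep G t → Indep G s := fun A S =>
    if h : G.IsIndepSet (A.image (p · S) : Set V) then ⟨⟨A.image (p · S), hs _ h⟩, h⟩
    else Indep.empty G s
  have hg : ∀ {S : Indep G t}, S.verts = S₀.verts.image (p · S) → ∀ A ⊆ S₀.verts,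
      (g A S).verts = A.image (p · S) := by
    intro S hS A hA
    have h : G.IsIndepSet (A.image (p · S) : Set V) := by
      refine S.isIndepSet.mono ?_
      rw [hS]
      exact_mod_cast Finset.image_subset_image hA
    exact congrArg Indep.verts (dif_pos h)
  refine ⟨g, fun A hA => ?_, ?_⟩
  · have hpS₀ : ∀ x ∈ S₀.verts, p x S₀ = x := by
      intro x hx
      exact tendsto_nhds_unique (tendsto_pure_nhds (p x) S₀)
        ((hp x hx).mono_left (pure_le_nhds _))
    refine Indep.tendsto_of_verts_eq (A := A) (fun x hx => hp x (hA hx))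
      (hev.mono fun S hS => hg hS.1 A hA) ?_
    rw [hg hev.self_of_nhds.1 A hA]
    conv_rhs => rw [← Finset.image_id (s := A)]
    exact Finset.image_congr fun x hx => hpS₀ x (hA hx)
  · filter_upwards [hev] with S hS
    refine ⟨by rw [hS.1, Finset.card_image_of_injOn hS.2], fun F => ?_⟩
    symm
    refine Finset.sum_bij (fun A _ => (g A S).verts) ?_ ?_ ?_ fun _ _ => rfl
    · intro A hA
      rw [Finset.mem_powerset] at hA ⊢
      rw [hg hS.1 A hA, hS.1]
      exact Finset.image_subset_image hA
    · intro A hA B hB hAB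
      rw [Finset.mem_powerset] at hA hB
      simp only [hg hS.1 A hA, hg hS.1 B hB] at hAB
      have := congrArg (fun T : Finset V => (T : Set V)) hAB
      simp only [Finset.coe_image] at this
      exact_mod_cast (hS.2.image_eq_image_iff (by exact_mod_cast hA) (by exact_mod_cast hB)).1 this
    · intro Q hQ
      rw [Finset.mem_powerset, hS.1] at hQ
      obtain ⟨A, hA, rfl⟩ := Finset.subset_image_iff.1 hQ
      exact ⟨A, by simpa using hA, hg hS.1 A (by simpa using hA)⟩

end Topology

/-! ### Möbius inversion on finite sets -/

section Moebius

variable {V : Type*}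

/-- The Möbius transform of a function on finite sets. -/
def moebius (F : Finset V → ℝ) (R : Finset V) : ℝ :=
  ∑ Q ∈ R.powerset, (-1) ^ (R.card + Q.card) * F Q

theorem moebius_congr {F F' : Finset V → ℝ} {R : Finset V} (h : ∀ Q ⊆ R, F Q = F' Q) :
    moebius F R = moebius F' R :=
  Finset.sum_congr rfl fun Q hQ => by rw [h Q (Finset.mem_powerset.1 hQ)]

theorem moebius_add (F F' : Finset V → ℝ) (R : Finset V) :
    moebius (fun Q => F Q + F' Q) R = moebius F R + moebius F' R := by
  simp only [moebius, mul_add, Finset.sum_add_distrib]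

/-- The transform at `insert x R` is the transform at `R` of the discrete derivative of `F` in
direction `x`; both inversion formulas follow by induction, with `F` varying. -/
theorem moebius_insert [DecidableEq V] (F : Finset V → ℝ) {x : V} {R : Finset V} (hx : x ∉ R) :
    moebius F (insert x R) = moebius (fun Q => F (insert x Q)) R - moebius F R := by
  unfold moebius
  rw [Finset.sum_powerset_insert hx, Finset.card_insert_of_notMem hx, add_comm,
    sub_eq_add_neg, ← Finset.sum_neg_distrib]
  congr 1
  · refine Finset.sum_congr rfl fun Q hQ => ?_
    rw [Finset.card_insert_of_notMem fun h => hx (Finset.mem_powerset.1 hQ h)]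
    ring
  · exact Finset.sum_congr rfl fun Q _ => by ring

theorem sum_powerset_moebius (F : Finset V → ℝ) (R : Finset V) :
    ∑ Q ∈ R.powerset, moebius F Q = F R := by
  classical
  induction R using Finset.induction_on generalizing F with
  | empty => simp [moebius]
  | insert x R hx ih =>
    rw [Finset.sum_powerset_insert hx, ← ih fun Q => F (insert x Q), ← Finset.sum_add_distrib]
    refine Finset.sum_congr rfl fun Q hQ => ?_
    rw [moebius_insert F fun h => hx (Finset.mem_powerset.1 hQ h)]
    ring

theorem moebius_sum_powerset (F : Finset V → ℝ) (R : Finset V) :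
    moebius (fun S => ∑ Q ∈ S.powerset, F Q) R = F R := by
  classical
  induction R using Finset.induction_on generalizing F with
  | empty => simp [moebius]
  | insert x R hx ih =>
    rw [moebius_insert _ hx, ← ih fun Q => F (insert x Q), sub_eq_iff_eq_add, ← moebius_add]
    refine moebius_congr fun Q hQ => ?_
    rw [Finset.sum_powerset_insert fun h => hx (hQ h), add_comm]

theorem moebius_one [DecidableEq V] (R : Finset V) : moebius (fun _ => 1) R = if R = ∅ then 1 else 0 := by
  rw [← moebius_sum_powerset (fun Q => if Q = ∅ then 1 else 0) R]
  exact moebius_congr fun Q _ => by simp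

end Moebius

/-! ### Sums over subsets of independent sets -/

section Subsets

open Filter Topology

variable {V : Type*} {G : SimpleGraph V} {s t : ℕ}

/-- The independent sets in `I_s` contained in `R`. -/
def Indep.subsets (G : SimpleGraph V) (s : ℕ) (R : Finset V) : Finset (Indep G s) :=
  (Indep.finite_subsets G s R).toFinset

theorem Indep.mem_subsets {R : Finset V} {Q : Indep G s} :
    Q ∈ Indep.subsets G s R ↔ Q.verts ⊆ R := by
  simp [Indep.subsets]

/-- All independent sets of `G` have at most `s` elements. -/
def IndepBound (G : SimpleGraph V) (s : ℕ) : Prop :=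
  ∀ S : Finset V, G.IsIndepSet (S : Set V) → S.card ≤ s

theorem IndepBound.sum_subsets (hs : IndepBound G s) {R : Finset V}
    (hR : G.IsIndepSet (R : Set V)) (F : Finset V → ℝ) :
    ∑ Q ∈ Indep.subsets G s R, F Q.verts = ∑ Q ∈ R.powerset, F Q := by
  refine Finset.sum_bij (fun Q _ => Q.verts) (fun Q hQ => ?_)
    (fun Q _ Q' _ h => Indep.verts_injective G s h) (fun Q hQ => ?_) fun _ _ => rfl
  · simpa [Indep.mem_subsets] using hQ
  · have hQ' : G.IsIndepSet (Q : Set V) :=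
      hR.mono (by exact_mod_cast Finset.mem_powerset.1 hQ)
    exact ⟨⟨⟨Q, hs Q hQ'⟩, hQ'⟩, Indep.mem_subsets.2 (Finset.mem_powerset.1 hQ), rfl⟩

/-- Extension by zero of a function on `I_s` to all finite sets. -/
def Indep.extend (f : Indep G s → ℝ) : Finset V → ℝ := Function.extend Indep.verts f 0

theorem Indep.extend_verts (f : Indep G s → ℝ) (S : Indep G s) :
    Indep.extend f S.verts = f S :=
  (Indep.verts_injective G s).extend_apply f 0 S

theorem IndepBound.sum_subsets_eq_extend (hs : IndepBound G s) {R : Finset V}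
    (hR : G.IsIndepSet (R : Set V)) (f : Indep G s → ℝ) :
    ∑ Q ∈ Indep.subsets G s R, f Q = ∑ Q ∈ R.powerset, Indep.extend f Q := by
  rw [← hs.sum_subsets hR]
  exact Finset.sum_congr rfl fun Q _ => (Indep.extend_verts f Q).symm

/-- The values of the zero extensions off the independent sets play no role, since only subsets of
the independent set `R` enter. -/
theorem moebius_extend_eq {f h : Indep G s → ℝ} (hs : IndepBound G s)
    (hfh : ∀ R : Indep G s, f R = ∑ Q ∈ Indep.subsets G s R.verts, h Q) (R : Indep G s) :
    moebius (Indep.extend f) R.verts = h R := by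
  rw [← Indep.extend_verts h, ← moebius_sum_powerset (Indep.extend h)]
  refine moebius_congr fun Q hQ => ?_
  have hQ' : G.IsIndepSet (Q : Set V) := R.isIndepSet.mono (by exact_mod_cast hQ)
  obtain ⟨Q, rfl⟩ : ∃ Q' : Indep G s, Q'.verts = Q := ⟨⟨⟨Q, hs Q hQ'⟩, hQ'⟩, rfl⟩
  rw [Indep.extend_verts, hfh, hs.sum_subsets_eq_extend hQ']

variable [TopologicalSpace V] [T2Space V]

theorem IsTopologicalPackingGraph.exists_local_sum_subsets (hG : IsTopologicalPackingGraph G)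
    (hs : IndepBound G s) (S₀ : Indep G t) :
    ∃ g : Finset V → Indep G t → Indep G s, (∀ A ⊆ S₀.verts, ContinuousAt (g A) S₀) ∧
      ∀ᶠ S in 𝓝 S₀, ∀ f : Indep G s → ℝ, ∑ Q ∈ Indep.subsets G s S.verts, f Q =
        ∑ A ∈ S₀.verts.powerset, f (g A S) := by
  obtain ⟨g, hg, hev⟩ := hG.exists_local_subsets hs S₀
  refine ⟨g, hg, hev.mono fun S hS f => ?_⟩
  rw [hs.sum_subsets_eq_extend S.isIndepSet, hS.2]
  exact Finset.sum_congr rfl fun A _ => Indep.extend_verts f _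

theorem IsTopologicalPackingGraph.continuous_sum_subsets (hG : IsTopologicalPackingGraph G)
    (hs : IndepBound G s) {f : Indep G s → ℝ} (hf : Continuous f) :
    Continuous fun S : Indep G t => ∑ Q ∈ Indep.subsets G s S.verts, f Q := by
  refine continuous_iff_continuousAt.2 fun S₀ => ?_
  obtain ⟨g, hg, hev⟩ := hG.exists_local_sum_subsets hs S₀
  have h : ContinuousAt (fun S => ∑ A ∈ S₀.verts.powerset, f (g A S)) S₀ :=
    tendsto_finsetSum _ fun A hA => hf.continuousAt.comp (hg A (Finset.mem_powerset.1 hA))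
  exact h.congr (hev.mono fun S hS => (hS f).symm)

theorem IsTopologicalPackingGraph.continuous_sum_subsets_prod (hG : IsTopologicalPackingGraph G)
    (hs : IndepBound G s) {K : Indep G s × Indep G s → ℝ} (hK : Continuous K) :
    Continuous fun S : Indep G t =>
      ∑ J ∈ Indep.subsets G s S.verts, ∑ J' ∈ Indep.subsets G s S.verts, K (J, J') := by
  refine continuous_iff_continuousAt.2 fun S₀ => ?_
  obtain ⟨g, hg, hev⟩ := hG.exists_local_sum_subsets hs S₀
  have h : ContinuousAt (fun S => ∑ A ∈ S₀.verts.powerset, ∑ B ∈ S₀.verts.powerset,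
      K (g A S, g B S)) S₀ :=
    tendsto_finsetSum _ fun A hA => tendsto_finsetSum _ fun B hB =>
      (hK.continuousAt (x := (g A S₀, g B S₀))).comp (f := fun S => (g A S, g B S))
        ((hg A (Finset.mem_powerset.1 hA)).prodMk (hg B (Finset.mem_powerset.1 hB)))
  refine h.congr (hev.mono fun S hS => ?_)
  simp only [hS]

theorem IsTopologicalPackingGraph.continuous_neg_one_pow_card (hG : IsTopologicalPackingGraph G)
    (ht : IndepBound G t) : Continuous fun S : Indep G t => (-1 : ℝ) ^ S.verts.card := by
  refine continuous_iff_continuousAt.2 fun S₀ => ?_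
  obtain ⟨_, _, hev⟩ := hG.exists_local_subsets ht S₀
  exact (continuousAt_const (y := (-1 : ℝ) ^ S₀.verts.card)).congr
    (hev.mono fun S hS => by simp only [hS.1])

end Subsets

/-! ### The zeta and Möbius transforms of continuous functions -/

section Transforms

variable {V : Type*} [TopologicalSpace V] {G : SimpleGraph V} {s t : ℕ}

/-- Each pair `J, J' ⊆ R` is counted once, at `S = J ∪ J'`, which is again a subset of `R`. -/
theorem sum_subsets_opA (ht : IndepBound G (2 * s)) (K : C(Indep G s × Indep G s, ℝ))
    (R : Indep G (2 * s)) :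
    ∑ S ∈ Indep.subsets G (2 * s) R.verts, opA G s K S =
      ∑ J ∈ Indep.subsets G s R.verts, ∑ J' ∈ Indep.subsets G s R.verts, K (J, J') := by
  classical
  have hmaps : ∀ p ∈ Indep.subsets G s R.verts ×ˢ Indep.subsets G s R.verts,
      p.1.verts ∪ p.2.verts ∈ R.verts.powerset := by
    rintro ⟨J, J'⟩ h
    rw [Finset.mem_product, Indep.mem_subsets, Indep.mem_subsets] at h
    exact Finset.mem_powerset.2 (Finset.union_subset h.1 h.2)
  rw [← Finset.sum_product', ← Finset.sum_fiberwise_of_maps_to hmaps,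
    ← ht.sum_subsets R.isIndepSet]
  refine Finset.sum_congr rfl fun S hS => Finset.sum_congr ?_ fun p _ => rfl
  rw [Indep.mem_subsets] at hS
  ext ⟨J, J'⟩
  simp only [Set.Finite.mem_toFinset, Set.mem_ofPred_eq, Finset.mem_filter, Finset.mem_product,
    Indep.mem_subsets]
  rw [← Finset.coe_union, Finset.coe_inj]
  refine ⟨fun h => ⟨⟨?_, ?_⟩, h⟩, And.right⟩
  · exact (h ▸ Finset.subset_union_left).trans hS
  · exact (h ▸ Finset.subset_union_right).trans hS

variable [T2Space V]

/-- The zeta transform `f ↦ (R ↦ ∑_{Q ⊆ R} f(Q))`. -/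
def zeta (hG : IsTopologicalPackingGraph G) (hs : IndepBound G s) (t : ℕ) :
    C(Indep G s, ℝ) →ₗ[ℝ] C(Indep G t, ℝ) where
  toFun f := ⟨fun R => ∑ Q ∈ Indep.subsets G s R.verts, f Q,
    hG.continuous_sum_subsets hs f.continuous⟩
  map_add' f g := by ext R; simp [Finset.sum_add_distrib]
  map_smul' c f := by ext R; simp [Finset.mul_sum]

/-- The Möbius transform `f ↦ (R ↦ ∑_{Q ⊆ R} (-1)^{|R \ Q|} f(Q))`. -/
def mob (hG : IsTopologicalPackingGraph G) (hs : IndepBound G s) (ht : IndepBound G t) :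
    C(Indep G s, ℝ) →ₗ[ℝ] C(Indep G t, ℝ) where
  toFun f := ⟨fun R => (-1) ^ R.verts.card *
      ∑ Q ∈ Indep.subsets G s R.verts, (-1) ^ Q.verts.card * f Q,
    (hG.continuous_neg_one_pow_card ht).mul
      (hG.continuous_sum_subsets hs ((hG.continuous_neg_one_pow_card hs).mul f.continuous))⟩
  map_add' f g := by ext R; simp [mul_add, Finset.sum_add_distrib]
  map_smul' c f := by ext R; simp [Finset.mul_sum, mul_left_comm]

/-- The double zeta transform `K ↦ (R ↦ ∑_{J, J' ⊆ R} K(J, J'))`. -/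
def doubleZeta (hG : IsTopologicalPackingGraph G) (hs : IndepBound G s) (t : ℕ) :
    C(Indep G s × Indep G s, ℝ) →ₗ[ℝ] C(Indep G t, ℝ) where
  toFun K := ⟨fun R => ∑ J ∈ Indep.subsets G s R.verts, ∑ J' ∈ Indep.subsets G s R.verts,
    K (J, J'), hG.continuous_sum_subsets_prod hs K.continuous⟩
  map_add' f g := by ext R; simp [Finset.sum_add_distrib]
  map_smul' c f := by ext R; simp [Finset.mul_sum]

variable (hG : IsTopologicalPackingGraph G) (hs : IndepBound G s) (ht : IndepBound G t)

theorem zeta_apply (f : C(Indep G s, ℝ)) (R : Indep G t) :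
    zeta hG hs t f R = ∑ Q ∈ Indep.subsets G s R.verts, f Q := rfl

theorem zeta_nonneg {f : C(Indep G s, ℝ)} (hf : ∀ S, 0 ≤ f S) (R : Indep G t) :
    0 ≤ zeta hG hs t f R :=
  Finset.sum_nonneg fun S _ => hf S

theorem doubleZeta_apply (K : C(Indep G s × Indep G s, ℝ)) (R : Indep G t) :
    doubleZeta hG hs t K R =
      ∑ J ∈ Indep.subsets G s R.verts, ∑ J' ∈ Indep.subsets G s R.verts, K (J, J') := rfl

theorem mob_apply (f : C(Indep G s, ℝ)) (R : Indep G t) :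
    mob hG hs ht f R = moebius (Indep.extend f) R.verts := by
  change (-1) ^ R.verts.card * ∑ Q ∈ Indep.subsets G s R.verts, (-1) ^ Q.verts.card * f Q = _
  rw [moebius, ← hs.sum_subsets R.isIndepSet, Finset.mul_sum]
  refine Finset.sum_congr rfl fun Q _ => ?_
  rw [Indep.extend_verts, pow_add, mul_assoc]

theorem zeta_mob (f : C(Indep G s, ℝ)) : zeta hG ht s (mob hG hs ht f) = f := by
  ext R
  rw [zeta_apply]
  simp only [mob_apply]
  rw [ht.sum_subsets R.isIndepSet, sum_powerset_moebius, Indep.extend_verts]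

theorem mob_zeta (f : C(Indep G s, ℝ)) : mob hG hs hs (zeta hG hs s f) = f := by
  ext R
  rw [mob_apply]
  exact moebius_extend_eq hs (fun R => rfl) R

/-- Möbius inversion of `sum_subsets_opA`; it also shows that `A K` is continuous. -/
theorem opA_eq_mob_doubleZeta (ht : IndepBound G (2 * s)) (K : C(Indep G s × Indep G s, ℝ)) :
    opA G s K = mob hG ht ht (doubleZeta hG hs (2 * s) K) := by
  ext R
  rw [mob_apply]
  exact (moebius_extend_eq ht (fun R => (sum_subsets_opA ht K R).symm) R).symm

theorem mob_one : mob hG hs hs (1 : C(Indep G s, ℝ)) (Indep.empty G s) = 1 ∧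
    ∀ S, S ≠ Indep.empty G s → mob hG hs hs (1 : C(Indep G s, ℝ)) S = 0 := by
  classical
  have key : ∀ S : Indep G s, mob hG hs hs (1 : C(Indep G s, ℝ)) S =
      if S.verts = ∅ then 1 else 0 := by
    intro S
    rw [← moebius_one, mob_apply]
    refine moebius_congr fun Q hQ => ?_
    have hQ' : G.IsIndepSet (Q : Set V) := S.isIndepSet.mono (by exact_mod_cast hQ)
    exact Indep.extend_verts _ (⟨⟨Q, hs Q hQ'⟩, hQ'⟩ : Indep G s)
  refine ⟨by rw [key]; exact if_pos rfl, fun S hS => ?_⟩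
  rw [key]
  exact if_neg fun h => hS (Indep.verts_injective G s h)

/-- The kernel `(J, J') ↦ h(J) h(J')`. -/
def rankOne {X : Type*} [TopologicalSpace X] (h : C(X, ℝ)) : C(X × X, ℝ) :=
  ⟨fun p => h p.1 * h p.2, by fun_prop⟩

theorem rankOne_mem_posDefKernels {X : Type*} [TopologicalSpace X] (h : C(X, ℝ)) :
    rankOne h ∈ posDefKernels X := by
  refine ⟨fun x y => mul_comm _ _, fun m x => ?_⟩
  have := Matrix.posSemidef_vecMulVec_self_star (R := ℝ) fun i => h (x i)
  convert this using 1
  ext i j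
  simp [rankOne, Matrix.vecMulVec_apply]

/-- The double sum of `h(J) h(J')` factors as the square of the zeta transform of `h`, and `zeta`
undoes `mob`. -/
theorem doubleZeta_rankOne_mob (g : C(Indep G t, ℝ)) :
    doubleZeta hG hs t (rankOne (mob hG ht hs g)) = g * g := by
  ext R
  have h : ∑ J ∈ Indep.subsets G s R.verts, mob hG ht hs g J = g R :=
    congrArg (fun f : C(Indep G t, ℝ) => f R) (zeta_mob hG ht hs g)
  rw [doubleZeta_apply, ContinuousMap.mul_apply, ← h, Finset.sum_mul_sum]
  rfl

/-- The value at `R` is the quadratic form of the matrix of `K` on the subsets of `R`, evaluated at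
the all-ones vector. -/
theorem doubleZeta_nonneg_of_posDef {K : C(Indep G s × Indep G s, ℝ)}
    (hK : K ∈ posDefKernels (Indep G s)) (R : Indep G t) : 0 ≤ doubleZeta hG hs t K R := by
  let T := Indep.subsets G s R.verts
  have h := (hK.2 T.card fun i => (T.equivFin.symm i : Indep G s)).dotProduct_mulVec_nonneg
    fun _ => 1
  have hsum : ∀ F : Indep G s → ℝ, ∑ i, F (T.equivFin.symm i) = ∑ J ∈ T, F J := fun F => by
    rw [← Finset.sum_coe_sort T]
    exact Equiv.sum_comp T.equivFin.symm fun J : T => F J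
  simp only [dotProduct, Matrix.mulVec, Matrix.of_apply, mul_one, Pi.star_apply, star_one,
    one_mul] at h
  rw [hsum fun J => ∑ j, K (J, T.equivFin.symm j)] at h
  refine h.trans_eq (Finset.sum_congr rfl fun J _ => hsum fun J' => K (J, J'))

theorem doubleZeta_swap (K : C(Indep G s × Indep G s, ℝ)) :
    doubleZeta hG hs t (K.comp (Homeomorph.prodComm (Indep G s) (Indep G s))) =
      doubleZeta hG hs t K := by
  ext R
  rw [doubleZeta_apply, doubleZeta_apply, Finset.sum_comm]
  rfl

end Transforms

/-! ### States on the continuous functions on a compact space -/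

section States

variable {X : Type*} [TopologicalSpace X]

/-- A normalized positive linear functional. -/
structure IsState (σ : C(X, ℝ) →ₗ[ℝ] ℝ) : Prop where
  nonneg : ∀ f : C(X, ℝ), (∀ x, 0 ≤ f x) → 0 ≤ σ f
  map_one : σ 1 = 1

theorem IsState.map_const {σ : C(X, ℝ) →ₗ[ℝ] ℝ} (hσ : IsState σ) (c : ℝ) :
    σ (ContinuousMap.const X c) = c := by
  have : ContinuousMap.const X c = c • (1 : C(X, ℝ)) := by ext; simp
  rw [this, map_smul, hσ.map_one, smul_eq_mul, mul_one]

theorem IsState.mono {σ : C(X, ℝ) →ₗ[ℝ] ℝ} (hσ : IsState σ) {f g : C(X, ℝ)}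
    (h : ∀ x, f x ≤ g x) : σ f ≤ σ g := by
  have := hσ.nonneg (g - f) fun x => by simpa using h x
  rwa [map_sub, sub_nonneg] at this

/-- A multiplicative linear functional is the evaluation at a point. -/
theorem exists_eq_eval_of_map_mul [CompactSpace X] {σ : C(X, ℝ) →ₗ[ℝ] ℝ} (h1 : σ 1 = 1)
    (hmul : ∀ f g : C(X, ℝ), σ (f * g) = σ f * σ g) : ∃ x, ∀ f : C(X, ℝ), σ f = f x := by
  by_contra! hcon
  have hker : ∀ x, ∃ f : C(X, ℝ), σ f = 0 ∧ f x ≠ 0 := by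
    intro x
    obtain ⟨f, hf⟩ := hcon x
    refine ⟨f - σ f • 1, by rw [map_sub, map_smul, h1]; simp, ?_⟩
    simpa [sub_ne_zero] using hf.symm
  choose f hf0 hfx using hker
  obtain ⟨T, hT⟩ := isCompact_univ.elim_finite_subcover (fun x => {y | f x y ≠ 0})
    (fun x => isOpen_ne_fun (f x).continuous continuous_const)
    fun x _ => Set.mem_iUnion.2 ⟨x, hfx x⟩
  -- By compactness finitely many kernel elements have no common zero, so this sum of squares is
  -- invertible, yet `σ` kills it.
  let F : C(X, ℝ) := ∑ x ∈ T, f x * f x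
  have hF : ∀ y, F y ≠ 0 := by
    intro y
    obtain ⟨x, hx, hxy⟩ : ∃ x ∈ T, f x y ≠ 0 := by simpa using hT (Set.mem_univ y)
    refine ne_of_gt ?_
    simp only [F, ContinuousMap.sum_apply, ContinuousMap.mul_apply]
    exact Finset.sum_pos' (fun z _ => mul_self_nonneg _) ⟨x, hx, mul_self_pos.2 hxy⟩
  let F' : C(X, ℝ) := ⟨fun y => (F y)⁻¹, F.continuous.inv₀ hF⟩
  have hFF' : F * F' = 1 := by
    ext y
    exact mul_inv_cancel₀ (hF y)
  have hσF : σ F = 0 := by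
    simp only [F, map_sum, hmul, hf0, mul_zero, Finset.sum_const_zero]
  have := hmul F F'
  rw [hFF', h1, hσF, zero_mul] at this
  exact one_ne_zero this

/-- Every `f` is an affine rescaling of a function `1/2 + c f` with values in `[1/4, 3/4]`, and
multiplicativity in the first factor survives this since `σ 1 = 1`. -/
theorem IsState.map_mul_of_forall_mem_Icc [CompactSpace X] {σ : C(X, ℝ) →ₗ[ℝ] ℝ}
    (hσ : IsState σ) (h : ∀ f : C(X, ℝ), (∀ x, f x ∈ Set.Icc (1 / 4 : ℝ) (3 / 4)) →
      ∀ g, σ (f * g) = σ f * σ g) (f g : C(X, ℝ)) : σ (f * g) = σ f * σ g := by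
  -- This makes `|c f| ≤ 1/4`; the `+ 1` covers `f = 0`.
  let c : ℝ := (4 * (‖f‖ + 1))⁻¹
  have hc : 0 < c := by positivity
  have hcf : ∀ x, |c * f x| ≤ 1 / 4 := by
    intro x
    have h1 : |f x| ≤ ‖f‖ + 1 := (f.norm_coe_le_norm x).trans (by linarith)
    rw [abs_mul, abs_of_pos hc]
    calc c * |f x| ≤ c * (‖f‖ + 1) := by gcongr
      _ = 1 / 4 := by simp only [c]; field_simp
  have key := h ((1 / 2 : ℝ) • 1 + c • f) (fun x => by
    have := abs_le.1 (hcf x)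
    simp only [ContinuousMap.add_apply, ContinuousMap.smul_apply, ContinuousMap.one_apply,
      smul_eq_mul, mul_one, Set.mem_Icc]
    constructor <;> linarith [this.1, this.2]) g
  rw [add_mul, smul_mul_assoc, smul_mul_assoc, one_mul, map_add, map_add, map_smul, map_smul,
    map_smul, map_smul, hσ.map_one] at key
  simp only [smul_eq_mul] at key
  have : c * (σ (f * g) - σ f * σ g) = 0 := by linarith
  rcases mul_eq_zero.1 this with h0 | h0
  · exact absurd h0 hc.ne'
  · linarith

/-- The state `g ↦ σ(f g) / σ(f)`. -/
theorem IsState.isState_mulLeft {σ : C(X, ℝ) →ₗ[ℝ] ℝ} (hσ : IsState σ) {f : C(X, ℝ)}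
    (hf : ∀ x, 0 ≤ f x) (hσf : 0 < σ f) :
    IsState ((σ f)⁻¹ • σ ∘ₗ LinearMap.mulLeft ℝ f) where
  nonneg g hg := mul_nonneg (inv_nonneg.2 hσf.le)
    (hσ.nonneg _ fun x => mul_nonneg (hf x) (hg x))
  map_one := by simp [hσf.ne']

theorem isState_eval (x : X) :
    IsState (ContinuousMap.evalCLM ℝ x : C(X, ℝ) →L[ℝ] ℝ).toLinearMap :=
  ⟨fun _ hf => hf x, rfl⟩

/-- Evaluations are extreme among the states. -/
theorem IsState.eq_eval_of_combination {σ τ : C(X, ℝ) →ₗ[ℝ] ℝ} (hσ : IsState σ) (hτ : IsState τ)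
    {a b : ℝ} (ha : 0 < a) (hb : 0 < b) {x : X}
    (h : ∀ f : C(X, ℝ), a * σ f + b * τ f = f x) (f : C(X, ℝ)) : σ f = f x := by
  have hzero : ∀ g : C(X, ℝ), (∀ y, 0 ≤ g y) → g x = 0 → σ g = 0 := by
    intro g hg hgx
    have h1 := h g
    rw [hgx] at h1
    have h2 := mul_nonneg hb.le (hτ.nonneg g hg)
    have h3 : a * σ g ≤ 0 := by linarith
    exact le_antisymm (nonpos_of_mul_nonpos_right h3 ha) (hσ.nonneg g hg)
  -- `|d|` is nonnegative and vanishes at `x`, so `σ` kills it, and `±d ≤ |d|` gives `σ d = 0`.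
  let d : C(X, ℝ) := f - ContinuousMap.const X (f x)
  have hd : σ |d| = 0 := hzero |d| (fun y => abs_nonneg _) (by simp [d])
  have h1 : σ d ≤ σ |d| := hσ.mono fun y => le_abs_self (d y)
  have h2 : σ (-d) ≤ σ |d| := hσ.mono fun y => neg_le_abs (d y)
  have h3 : σ d = σ f - f x := by rw [map_sub, hσ.map_const]
  rw [map_neg] at h2
  linarith

end States

/-! ### The feasible region in terms of states -/

section Feasible

variable {V : Type*} [TopologicalSpace V] [T2Space V] {G : SimpleGraph V} {s : ℕ}

theorem isSignedRadon_chi (R : Indep G s) : IsSignedRadon (chi G s R) :=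
  isSignedRadon_sum _ _ fun Q _ => isSignedRadon_delta Q

variable [CompactSpace V]

theorem exists_state_of_mem_feasibleRegion (hG : IsTopologicalPackingGraph G) (hs : IndepBound G s)
    (ht : IndepBound G (2 * s))
    {lam : BorelSignedMeasure (Indep G (2 * s))}
    (hlam : lam ∈ feasibleRegion G s) :
    ∃ σ : C(Indep G (2 * s), ℝ) →ₗ[ℝ] ℝ, IsState σ ∧
      ∀ f : C(Indep G (2 * s), ℝ), pairing f lam = σ (zeta hG ht (2 * s) f) := by
  have := hG.compactSpace_indep (2 * s)
  obtain ⟨⟨hrad, -⟩, hempty, μ, ⟨-, hadj⟩, -, hpos⟩ := hlam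
  let σ : C(Indep G (2 * s), ℝ) →ₗ[ℝ] ℝ :=
    { toFun := fun f => pairing (mob hG ht ht f) lam
      map_add' := fun f g => by rw [map_add, hrad.pairing_add]
      map_smul' := fun c f => by rw [map_smul, pairing_smul]; rfl }
  have hsq : ∀ g : C(Indep G (2 * s), ℝ), 0 ≤ σ (g * g) := by
    intro g
    have hK := rankOne_mem_posDefKernels (mob hG ht hs g)
    have h := hpos _ hK
    rw [hadj _ hK.1, opA_eq_mob_doubleZeta hG hs ht, doubleZeta_rankOne_mob] at h
    exact h
  refine ⟨σ, ⟨fun f hf => ?_, ?_⟩, fun f => ?_⟩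
  -- Nonnegativity on squares suffices, as a nonnegative continuous function is the square of its
  -- root.
  · let g : C(Indep G (2 * s), ℝ) := ⟨fun x => Real.sqrt (f x), f.continuous.sqrt⟩
    have : f = g * g := by
      ext x
      exact (Real.mul_self_sqrt (hf x)).symm
    rw [this]
    exact hsq g
  · have h := mob_one hG ht
    exact (hrad.pairing_eq_apply_singleton _ h.1 h.2).trans hempty
  · change _ = pairing (mob hG ht ht (zeta hG ht (2 * s) f)) lam
    rw [mob_zeta]

theorem exists_mem_feasibleRegion_of_state (hG : IsTopologicalPackingGraph G) (hs : IndepBound G s)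
    (ht : IndepBound G (2 * s))
    {σ : C(Indep G (2 * s), ℝ) →ₗ[ℝ] ℝ} (hσ : IsState σ) :
    ∃ lam ∈ feasibleRegion G s, ∀ f : C(Indep G (2 * s), ℝ), pairing f lam = σ (zeta hG ht (2 * s) f) := by
  have := hG.compactSpace_indep (2 * s)
  have := hG.compactSpace_indep s
  obtain ⟨lam, hlam, hpair⟩ := exists_positiveRadon_of_positive (σ ∘ₗ zeta hG ht (2 * s))
    fun f hf => hσ.nonneg _ (zeta_nonneg hG ht hf)
  obtain ⟨μ, hμ, hμpair⟩ := exists_symMeasure_of_positive (σ ∘ₗ doubleZeta hG hs (2 * s))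
    (fun K hK => hσ.nonneg _ fun R =>
      Finset.sum_nonneg fun J _ => Finset.sum_nonneg fun J' _ => hK (J, J'))
    (fun K => by rw [LinearMap.comp_apply, LinearMap.comp_apply, doubleZeta_swap])
  refine ⟨lam, ⟨hlam, ?_, μ, ⟨hμ, fun K _ => ?_⟩, hμ, fun K hK => ?_⟩, hpair⟩
  · have h := mob_one hG ht
    rw [← hlam.1.pairing_eq_apply_singleton _ h.1 h.2, hpair, LinearMap.comp_apply, zeta_mob,
      hσ.map_one]
  · rw [opA_eq_mob_doubleZeta hG hs ht, hpair, hμpair, LinearMap.comp_apply, LinearMap.comp_apply,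
      zeta_mob]
  · rw [hμpair]
    exact hσ.nonneg _ (doubleZeta_nonneg_of_posDef hG hs hK)

theorem pairing_chi (hG : IsTopologicalPackingGraph G) (ht : IndepBound G (2 * s))
    (R : Indep G s) (R' : Indep G (2 * s)) (hR : R'.verts = R.verts)
    (f : C(Indep G (2 * s), ℝ)) :
    pairing f (chi G s R) = zeta hG ht (2 * s) f R' := by
  have := hG.compactSpace_indep (2 * s)
  rw [chi, pairing_sum_delta, zeta_apply, hR]
  rfl

theorem chi_mem_extremePoints (hG : IsTopologicalPackingGraph G) (hs : IndepBound G s)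
    (ht : IndepBound G (2 * s))
    (R : Indep G s) :
    chi G s R ∈ Set.extremePoints ℝ (feasibleRegion G s) := by
  have := hG.compactSpace_indep (2 * s)
  -- The same vertex set, viewed in `I_{2s}`: the bounds `s` and `2s` give different types for the
  -- same independent sets.
  let R' : Indep G (2 * s) := ⟨⟨R.verts, ht _ R.isIndepSet⟩, R.isIndepSet⟩
  have hchi := pairing_chi hG ht R R' rfl
  constructor
  · obtain ⟨lam, hlam, h⟩ := exists_mem_feasibleRegion_of_state hG hs ht (isState_eval R')
    have : chi G s R = lam :=
      (isSignedRadon_chi R).ext hlam.1.1 fun f => by rw [h, hchi]; rfl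
    rwa [this]
  · rintro lam₁ h₁ lam₂ h₂ ⟨a, b, ha, hb, -, hab⟩
    obtain ⟨σ, hσ, hσlam⟩ := exists_state_of_mem_feasibleRegion hG hs ht h₁
    obtain ⟨τ, hτ, hτlam⟩ := exists_state_of_mem_feasibleRegion hG hs ht h₂
    refine h₁.1.1.ext (isSignedRadon_chi R) fun f => ?_
    rw [hσlam, hchi]
    refine hσ.eq_eval_of_combination hτ ha hb (fun g => ?_) _
    have h := hchi (mob hG ht ht g)
    rwa [← hab, pairing_combination h₁.1.1 h₂.1.1, hσlam, hτlam, zeta_mob] at h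

theorem exists_eq_chi_of_mem_extremePoints (hG : IsTopologicalPackingGraph G) (hs : IndepBound G s)
    (ht : IndepBound G (2 * s))
    {lam : BorelSignedMeasure (Indep G (2 * s))}
    (hlam : lam ∈ Set.extremePoints ℝ (feasibleRegion G s)) :
    ∃ R : Indep G s, lam = chi G s R := by
  have := hG.compactSpace_indep (2 * s)
  obtain ⟨hfeas, hext⟩ := hlam
  obtain ⟨σ, hσ, hσlam⟩ := exists_state_of_mem_feasibleRegion hG hs ht hfeas
  -- Split `σ` as the convex combination of the states `σ(f ·)/σ(f)` and `σ((1 - f) ·)/σ(1 - f)`;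
  -- bounds `1/4` and `3/4` keep both weights positive. Extremality of `lam` forces the first state
  -- to equal `σ`, which is multiplicativity.
  have hmul : ∀ f g : C(Indep G (2 * s), ℝ), σ (f * g) = σ f * σ g := by
    refine hσ.map_mul_of_forall_mem_Icc fun f hf g => ?_
    have ha : 0 < σ f := by
      have := hσ.mono (f := ContinuousMap.const _ (1 / 4)) fun x => (hf x).1
      rw [hσ.map_const] at this
      linarith
    have hb : σ (1 - f) = 1 - σ f := by rw [map_sub, hσ.map_one]
    have hb' : 0 < σ (1 - f) := by
      have := hσ.mono (g := ContinuousMap.const _ (3 / 4)) fun x => (hf x).2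
      rw [hσ.map_const] at this
      linarith
    obtain ⟨lam₁, h₁, hp₁⟩ := exists_mem_feasibleRegion_of_state hG hs ht
      (hσ.isState_mulLeft (fun x => le_trans (by norm_num) (hf x).1) ha)
    obtain ⟨lam₂, h₂, hp₂⟩ := exists_mem_feasibleRegion_of_state hG hs ht
      (hσ.isState_mulLeft (f := 1 - f) (fun x => by
        have := (hf x).2
        simp only [ContinuousMap.sub_apply, ContinuousMap.one_apply]
        linarith) hb')
    have hcomb : σ f • lam₁ + σ (1 - f) • lam₂ = lam := by
      refine ((h₁.1.1.smul_of_nonneg ha.le).add (h₂.1.1.smul_of_nonneg hb'.le)).ext hfeas.1.1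
        fun h => ?_
      rw [pairing_combination h₁.1.1 h₂.1.1, hp₁, hp₂, hσlam]
      simp only [LinearMap.smul_apply, LinearMap.comp_apply, LinearMap.mulLeft_apply, smul_eq_mul]
      rw [mul_inv_cancel_left₀ ha.ne', mul_inv_cancel_left₀ hb'.ne', ← map_add, ← add_mul,
        add_sub_cancel, one_mul]
    have heq := hext h₁ h₂ ⟨σ f, σ (1 - f), ha, hb', by rw [hb]; ring, hcomb⟩
    have h := hp₁ (mob hG ht ht g)
    rw [heq, hσlam, zeta_mob] at h
    simp only [LinearMap.smul_apply, LinearMap.comp_apply, LinearMap.mulLeft_apply,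
      smul_eq_mul] at h
    rw [h, mul_inv_cancel_left₀ ha.ne']
  obtain ⟨R', hR'⟩ := exists_eq_eval_of_map_mul hσ.map_one hmul
  let R : Indep G s := ⟨⟨R'.verts, hs _ R'.isIndepSet⟩, R'.isIndepSet⟩
  refine ⟨R, hfeas.1.1.ext (isSignedRadon_chi R) fun f => ?_⟩
  rw [hσlam, hR', pairing_chi hG ht R R' rfl]

end Feasible

end PackingGraph

end

theorem mainTheorem5 {V : Type*} [TopologicalSpace V] [T2Space V] [CompactSpace V]
    (G : SimpleGraph V) (hG : PackingGraph.IsTopologicalPackingGraph G) :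
    Set.extremePoints ℝ (PackingGraph.feasibleRegion G G.indepNum) =
      {lam | ∃ R : PackingGraph.Indep G G.indepNum, lam = PackingGraph.chi G G.indepNum R} := by
  have hs : PackingGraph.IndepBound G G.indepNum := fun _ hS => hG.card_le_indepNum hS
  have ht : PackingGraph.IndepBound G (2 * G.indepNum) := fun S hS => (hs S hS).trans (by omega)
  ext lam
  refine ⟨PackingGraph.exists_eq_chi_of_mem_extremePoints hG hs ht, ?_⟩
  rintro ⟨R, rfl⟩
  exact PackingGraph.chi_mem_extremePoints hG hs ht R
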